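/- Let $\mathbb{S}^2\subset\mathbb{R}^3$ be the unit sphere, let $\mu$ be the surface (Lebesgue) measure on $\mathbb{S}^2$ normalized so that $\mu(\mathbb{S}^2)=1$, and let $d(p,q)\in[0,\pi]$ be the geodesic distance. A set $S\subseteq\mathbb{S}^2$ is orthogonal-pair-free if no two points of $S$ are at distance $\frac{\pi}{2}$. A set $C\subseteq\mathbb{S}^2$ is (spherically) convex if for all $x,y\in C$ with $y\neq -x$ the geodesic segment $\overline{xy}$ (the shorter great-circle arc) lies in $C$. Let $\alpha_3$ be the supremum of $\mu(S)$ over all Lebesgue measurable orthogonal-pair-free sets $S\subseteq\mathbb{S}^2$, and let $\mathcal{A}$ be the collection of all orthogonal-pair-free sets $S\subseteq\mathbb{S}^2$ that are unions of finitely many convex sets with pairwise disjoint closures. Let $D$ be the double cap, the union of the two open geodesic discs of radius $\frac{\pi}{4}$ centred at the north and south poles; the double cap conjecture asserts $\alpha_3=\mu(D)$. Then every $S\in\mathcal{A}$ is Lebesgue measurable, and $$\alpha_3=\sup_{S\in\mathcal{A}}\mu(S).$$ Moreover $\mu(D)=1-\frac{1}{\sqrt2}$, and if the double cap conjecture is not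 true, then there exists $S\in\mathcal{A}$ with $\mu(S)>\mu(D)=1-\frac1{\sqrt2}$. -/

import Mathlib

open MeasureTheory

noncomputable section

namespace OrthFree

/-- Euclidean three-space. -/
abbrev E3 : Type := EuclideanSpace ℝ (Fin 3)

/-- The unit sphere `𝕊²` in `ℝ³`, with the subspace topology and Borel σ-algebra. -/
abbrev S2 : Type := Metric.sphere (0 : E3) 1

/-- The surface measure on `𝕊²`, normalized to total mass one. -/
def μ : Measure S2 :=
  ((volume : Measure E3).toSphere Set.univ)⁻¹ • (volume : Measure E3).toSphere

/-- The geodesic distance on `𝕊²`: the angle between the two rays from the origin. -/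
def geoDist (p q : S2) : ℝ := InnerProductGeometry.angle (p : E3) (q : E3)

/-- A set without two points at geodesic distance `π / 2`. -/
def OrthogonalPairFree (S : Set S2) : Prop :=
  ∀ p ∈ S, ∀ q ∈ S, geoDist p q ≠ Real.pi / 2

/-- The geodesic segment between two non-antipodal points `x`, `y`: the part of the sphere
in the cone spanned by `x` and `y`, that is, the shorter great-circle arc. -/
def geoSegment (x y : S2) : Set S2 :=
  {z | ∃ a b : ℝ, 0 ≤ a ∧ 0 ≤ b ∧ (z : E3) = a • (x : E3) + b • (y : E3)}

/-- Spherical convexity: the set contains the geodesic segment between any two of its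
non-antipodal points. -/
def SphericallyConvex (C : Set S2) : Prop :=
  ∀ x ∈ C, ∀ y ∈ C, (y : E3) ≠ -(x : E3) → geoSegment x y ⊆ C

/-- The collection `𝒜`: orthogonal-pair-free sets which are unions of finitely many spherically
convex sets with pairwise disjoint closures. -/
def classA : Set (Set S2) :=
  {S | OrthogonalPairFree S ∧
    ∃ (n : ℕ) (C : Fin n → Set S2),
      (∀ i, SphericallyConvex (C i)) ∧
      (∀ i j, i ≠ j → Disjoint (closure (C i)) (closure (C j))) ∧
      S = ⋃ i, C i}

/-- The supremum of the measures of all Lebesgue measurable orthogonal-pair-free sets.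
`NullMeasurableSet` is measurability for the completion of `μ`. -/
def α₃ : ENNReal := ⨆ (S : Set S2) (_ : NullMeasurableSet S μ ∧ OrthogonalPairFree S), μ S

/-- The north pole `(0, 0, 1)`. -/
def northPole : S2 := ⟨EuclideanSpace.single 2 1, by simp⟩

/-- The double cap: the two open geodesic discs of radius `π / 4` around the poles. -/
def doubleCap : Set S2 :=
  {p | geoDist northPole p < Real.pi / 4} ∪ {p | geoDist (-northPole) p < Real.pi / 4}

/-- The double cap conjecture: the supremum `α₃` is attained by the double cap. -/
def DoubleCapConjecture : Prop := α₃ = μ doubleCap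

end OrthFree

end

namespace OrthFree

open scoped Pointwise RealInnerProductSpace

/-! Members of `classA` are measurable because an orthogonal-pair-free convex set either lies in an
antipodal pair or spans a convex cone in space, whose frontier is Lebesgue null.

For the supremum, inner regularity replaces `S` by a compact `K` of nearly the same measure, and
compactness gives `c > 0` with `|⟪p, q⟫| ≥ c` on `K`. Finitely many great circles cut the sphere
into cells in which any two points are closer than `c / 2`. Moving the cell walls inwards by `η`
makes the closures disjoint, keeps convexity and costs little measure. Each point of a shrunken cell
meeting `K` is within `c / 2` of `K`, so two such points cannot be orthogonal
(`iUnion_cell_mem_classA`).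

The double cap is itself admissible, so failure of the conjecture means `μ doubleCap < α₃`, and the
supremum formula yields a better member of `classA`. -/

theorem norm_coe_S2 (x : S2) : ‖(x : E3)‖ = 1 := mem_sphere_zero_iff_norm.mp x.2

theorem geoDist_eq_pi_div_two_iff (p q : S2) :
    geoDist p q = Real.pi / 2 ↔ ⟪(p : E3), (q : E3)⟫ = 0 :=
  (InnerProductGeometry.inner_eq_zero_iff_angle_eq_pi_div_two _ _).symm

theorem orthogonalPairFree_iff (S : Set S2) :
    OrthogonalPairFree S ↔ ∀ p ∈ S, ∀ q ∈ S, ⟪(p : E3), (q : E3)⟫ ≠ 0 := by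
  simp only [OrthogonalPairFree, ne_eq, geoDist_eq_pi_div_two_iff]

theorem OrthogonalPairFree.mono {S T : Set S2} (h : OrthogonalPairFree T) (hST : S ⊆ T) :
    OrthogonalPairFree S := fun p hp q hq => h p (hST hp) q (hST hq)

/-! ### Surface measure as volume of cones -/

theorem toSphere_univ_eq :
    (volume : Measure E3).toSphere Set.univ = 3 * volume (Metric.ball (0 : E3) 1) := by
  simp

theorem μ_apply {s : Set S2} (hs : MeasurableSet s) :
    μ s = (volume (Metric.ball (0 : E3) 1))⁻¹ *
      volume (Set.Ioo (0 : ℝ) 1 • ((↑) '' s : Set E3)) := by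
  rw [μ, Measure.smul_apply, toSphere_univ_eq, Measure.toSphere_apply' _ hs, smul_eq_mul,
    ENNReal.mul_inv (by simp) (by simp)]
  have h3 : (3 : ENNReal)⁻¹ * 3 = 1 := ENNReal.inv_mul_cancel (by simp) (by simp)
  simp only [finrank_euclideanSpace, Fintype.card_fin, Nat.cast_ofNat]
  rw [mul_comm (3 : ENNReal)⁻¹, mul_assoc, ← mul_assoc (3 : ENNReal)⁻¹, h3, one_mul]

instance : IsFiniteMeasure μ := by
  refine ⟨?_⟩
  rw [μ_apply MeasurableSet.univ]
  refine ENNReal.mul_lt_top ?_ ?_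
  · rw [ENNReal.inv_lt_top]
    exact Metric.measure_ball_pos _ _ one_pos
  · refine (measure_mono ?_).trans_lt (measure_ball_lt_top (μ := volume) (x := (0 : E3)) (r := 1))
    rintro _ ⟨r, hr, _, ⟨x, -, rfl⟩, rfl⟩
    simp [norm_smul, abs_of_pos hr.1, hr.2]

/-- The trace on the sphere of a null set closed under positive scaling is null. -/
theorem μ_eq_zero_of_cone {s : Set S2} (hs : MeasurableSet s) {N : Set E3}
    (hN : volume N = 0) (h : ∀ x ∈ s, ∀ r : ℝ, 0 < r → r • (x : E3) ∈ N) : μ s = 0 := by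
  rw [μ_apply hs]
  refine mul_eq_zero_of_right _ (measure_mono_null ?_ hN)
  rintro _ ⟨r, hr, _, ⟨x, hx, rfl⟩, rfl⟩
  exact h x hx r hr.1

theorem continuous_inner_S2 (v : E3) : Continuous fun x : S2 => ⟪(x : E3), v⟫ := by fun_prop

theorem μ_greatCircle {v : E3} (hv : v ≠ 0) : μ {x : S2 | ⟪(x : E3), v⟫ = 0} = 0 := by
  refine μ_eq_zero_of_cone (N := ((ℝ ∙ v)ᗮ : Submodule ℝ E3))
    (isClosed_eq (continuous_inner_S2 v) continuous_const).measurableSet ?_ ?_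
  · refine Measure.addHaar_submodule _ _ fun h => hv ?_
    rw [Submodule.orthogonal_eq_top_iff] at h
    simpa using h
  · intro x hx r _
    rw [SetLike.mem_coe, Submodule.mem_orthogonal_singleton_iff_inner_left, inner_smul_left,
      show ⟪(x : E3), v⟫ = 0 from hx, mul_zero]

/-! ### Measurability of convex orthogonal-pair-free sets -/

/-- The positive multiples of the points of a set on the sphere. -/
def coneOver (C : Set S2) : Set E3 := {y | ∃ r : ℝ, 0 < r ∧ ∃ c ∈ C, y = r • (c : E3)}

theorem smul_coneOver (C : Set S2) {t : ℝ} (ht : 0 < t) : t • coneOver C = coneOver C := by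
  ext y
  rw [Set.mem_smul_set_iff_inv_smul_mem₀ ht.ne']
  constructor
  · rintro ⟨r, hr, c, hc, h⟩
    exact ⟨t * r, mul_pos ht hr, c, hc, by rw [mul_smul, ← h, smul_inv_smul₀ ht.ne']⟩
  · rintro ⟨r, hr, c, hc, rfl⟩
    exact ⟨t⁻¹ * r, mul_pos (inv_pos.2 ht) hr, c, hc, by rw [mul_smul]⟩

theorem coe_mem_coneOver {C : Set S2} {x : S2} : (x : E3) ∈ coneOver C ↔ x ∈ C := by
  constructor
  · rintro ⟨r, hr, c, hc, h⟩
    have h1 : r = 1 := by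
      have := congrArg norm h
      rw [norm_smul, norm_coe_S2, norm_coe_S2, mul_one, Real.norm_of_nonneg hr.le] at this
      exact this.symm
    rw [h1, one_smul] at h
    rwa [Subtype.ext h]
  · exact fun h => ⟨1, one_pos, x, h, (one_smul _ _).symm⟩

theorem smul_mem_frontier_coneOver {C : Set S2} {x : E3} (hx : x ∈ frontier (coneOver C))
    {t : ℝ} (ht : 0 < t) : t • x ∈ frontier (coneOver C) := by
  rw [frontier, ← smul_coneOver C ht, closure_smul₀, interior_smul₀ ht.ne',
    ← Set.smul_set_sdiff₀ ht.ne']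
  exact Set.smul_mem_smul_set hx

/-- A nonzero nonnegative combination, rescaled to the sphere, lies on the geodesic segment. -/
theorem exists_mem_geoSegment {x y : S2} {a b : ℝ} (ha : 0 ≤ a) (hb : 0 ≤ b)
    (h : a • (x : E3) + b • (y : E3) ≠ 0) :
    ∃ z ∈ geoSegment x y, a • (x : E3) + b • (y : E3) =
      ‖a • (x : E3) + b • (y : E3)‖ • (z : E3) := by
  set w := a • (x : E3) + b • (y : E3) with hw
  have hpos : 0 < ‖w‖ := norm_pos_iff.2 h
  refine ⟨⟨‖w‖⁻¹ • w, ?_⟩, ⟨‖w‖⁻¹ * a, ‖w‖⁻¹ * b, by positivity, by positivity, ?_⟩, ?_⟩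
  · rw [mem_sphere_zero_iff_norm, norm_smul, norm_inv, norm_norm, inv_mul_cancel₀ hpos.ne']
  · simp only [hw, smul_add, mul_smul]
  · simp only [smul_inv_smul₀ hpos.ne']

/-- Without antipodal pairs a convex combination of cone points never vanishes, so it rescales to a
point of a geodesic segment. -/
theorem convex_coneOver {C : Set S2} (hC : SphericallyConvex C)
    (hanti : ∀ x ∈ C, ∀ y ∈ C, (y : E3) ≠ -(x : E3)) : Convex ℝ (coneOver C) := by
  rintro _ ⟨r, hr, c, hc, rfl⟩ _ ⟨s, hs, d, hd, rfl⟩ a b ha hb hab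
  rw [smul_smul, smul_smul]
  have har : 0 ≤ a * r := by positivity
  have hbs : 0 ≤ b * s := by positivity
  have hne : (a * r) • (c : E3) + (b * s) • (d : E3) ≠ 0 := by
    intro h
    have h1 : (b * s) • (d : E3) = -((a * r) • (c : E3)) := eq_neg_of_add_eq_zero_right h
    have h2 : b * s = a * r := by
      have := congrArg norm h1
      rwa [norm_neg, norm_smul, norm_smul, norm_coe_S2, norm_coe_S2, mul_one, mul_one,
        Real.norm_of_nonneg har, Real.norm_of_nonneg hbs] at this
    have h3 : 0 < b * s := by
      rcases hb.lt_or_eq with hb | hb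
      · positivity
      · have : a = 1 := by linarith
        rw [h2, this]; linarith
    rw [← h2, ← smul_neg] at h1
    exact hanti c hc d hd (smul_right_injective E3 h3.ne' h1)
  obtain ⟨z, hz, h⟩ := exists_mem_geoSegment har hbs hne
  exact ⟨_, norm_pos_iff.2 hne, z, hC c hc d hd (hanti c hc d hd) hz, h⟩

/-- A convex orthogonal-pair-free set with an antipodal pair is just that pair. -/
theorem subset_pair_of_antipodal {C : Set S2} (hC : SphericallyConvex C)
    (hfree : OrthogonalPairFree C) {x : S2} (hx : x ∈ C) (hx' : -x ∈ C) : C ⊆ {x, -x} := by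
  intro y hy
  by_contra hxy
  simp only [Set.mem_insert_iff, Set.mem_singleton_iff, not_or] at hxy
  rw [orthogonalPairFree_iff] at hfree
  -- The vector `y - ⟪x, y⟫ x` is orthogonal to `x`. With `u = -x` or `u = x`, by the sign of `⟪x,
  -- y⟫`, it is a nonnegative combination of points of `C`, so its normalization lies in `C`.
  have key : ∀ u ∈ C, (u : E3) ≠ -(y : E3) → ∀ b : ℝ, 0 ≤ b →
      ⟪(x : E3), (1 : ℝ) • (y : E3) + b • (u : E3)⟫ = 0 →
      (1 : ℝ) • (y : E3) + b • (u : E3) ≠ 0 → False := by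
    intro u hu huy b hb hin hne
    obtain ⟨z, hz, h⟩ := exists_mem_geoSegment zero_le_one hb hne
    rw [h, inner_smul_right, mul_eq_zero, or_iff_right (norm_ne_zero_iff.2 hne)] at hin
    exact hfree x hx z (hC y hy u hu huy hz) hin
  have hne : ∀ c : ℝ, (y : E3) ≠ c • (x : E3) := by
    intro c h
    have h1 := congrArg norm h
    rw [norm_smul, norm_coe_S2, norm_coe_S2, mul_one, Real.norm_eq_abs] at h1
    rcases (abs_eq zero_le_one).1 h1.symm with rfl | rfl
    · exact hxy.1 (Subtype.ext (by simpa using h))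
    · exact hxy.2 (Subtype.ext (by simpa using h))
  rcases le_total 0 ⟪(x : E3), (y : E3)⟫ with h | h
  · refine key (-x) hx' ?_ _ h ?_ ?_
    · intro h'
      exact hxy.1 (Subtype.ext (by simpa using h'.symm))
    · simp [inner_add_right, inner_smul_right]
    · intro h0
      refine hne ⟪(x : E3), (y : E3)⟫ ?_
      simpa [← sub_eq_add_neg, sub_eq_zero] using h0
  · refine key x hx ?_ (-⟪(x : E3), (y : E3)⟫) (by linarith) ?_ ?_
    · intro h'
      exact hxy.2 (Subtype.ext (by simp [h']))
    · simp [inner_add_right, inner_smul_right]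
    · intro h0
      refine hne ⟪(x : E3), (y : E3)⟫ ?_
      simpa [← sub_eq_add_neg, sub_eq_zero] using h0

/-- `C` differs from the trace of the interior of its cone by a subset of the trace of the frontier,
which is null; with an antipodal pair `C` is finite. -/
theorem SphericallyConvex.nullMeasurableSet {C : Set S2} (hC : SphericallyConvex C)
    (hfree : OrthogonalPairFree C) : NullMeasurableSet C μ := by
  by_cases hanti : ∀ x ∈ C, ∀ y ∈ C, (y : E3) ≠ -(x : E3)
  · have hcont : Continuous ((↑) : S2 → E3) := continuous_subtype_val
    have hA : MeasurableSet ((↑) ⁻¹' interior (coneOver C) : Set S2) :=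
      (isOpen_interior.preimage hcont).measurableSet
    have hF : MeasurableSet ((↑) ⁻¹' frontier (coneOver C) : Set S2) :=
      (isClosed_frontier.preimage hcont).measurableSet
    have hnull : μ ((↑) ⁻¹' frontier (coneOver C) : Set S2) = 0 :=
      μ_eq_zero_of_cone hF ((convex_coneOver hC hanti).addHaar_frontier volume)
        fun x hx r hr => smul_mem_frontier_coneOver hx hr
    have hsub : C \ (↑) ⁻¹' interior (coneOver C) ⊆ (↑) ⁻¹' frontier (coneOver C) :=
      fun x hx => ⟨subset_closure (coe_mem_coneOver.2 hx.1), hx.2⟩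
    have hle : (↑) ⁻¹' interior (coneOver C) ⊆ C :=
      fun x hx => coe_mem_coneOver.1 (interior_subset hx)
    rw [← Set.union_sdiff_cancel hle]
    exact hA.nullMeasurableSet.union (NullMeasurableSet.of_null (measure_mono_null hsub hnull))
  · push Not at hanti
    obtain ⟨x, hx, y, hy, hxy⟩ := hanti
    have hy' : y = -x := Subtype.ext hxy
    have := subset_pair_of_antipodal hC hfree hx (hy' ▸ hy)
    exact ((Set.toFinite {x, -x}).subset this).measurableSet.nullMeasurableSet

theorem nullMeasurableSet_of_mem_classA {S : Set S2} (hS : S ∈ classA) :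
    NullMeasurableSet S μ := by
  obtain ⟨hfree, n, C, hC, -, rfl⟩ := hS
  exact NullMeasurableSet.iUnion fun i =>
    (hC i).nullMeasurableSet (hfree.mono (Set.subset_iUnion C i))

/-! ### Approximation by unions of shrunken cells -/

/-- Finitely many great circles separate all pairs of points at distance at least `δ`. -/
theorem exists_finset_separating {δ : ℝ} (hδ : 0 < δ) :
    ∃ V : Finset E3, (∀ v ∈ V, v ≠ 0) ∧ ∀ x y : S2,
      (∀ v ∈ V, 0 < ⟪(x : E3), v⟫ → ¬ ⟪(y : E3), v⟫ < 0) → dist x y < δ := by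
  classical
  have hK : IsCompact {p : S2 × S2 | δ ≤ dist p.1 p.2} :=
    (isClosed_le continuous_const continuous_dist).isCompact
  obtain ⟨V, hV⟩ := hK.elim_finite_subcover
    (fun v : E3 => {p : S2 × S2 | 0 < ⟪(p.1 : E3), v⟫ ∧ ⟪(p.2 : E3), v⟫ < 0})
    (fun v => (isOpen_lt continuous_const ((continuous_inner_S2 v).comp continuous_fst)).inter
      (isOpen_lt ((continuous_inner_S2 v).comp continuous_snd) continuous_const))
    (by
      rintro ⟨x, y⟩ hxy
      have hne : (x : E3) ≠ (y : E3) := by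
        intro h
        have h' : x = y := Subtype.ext h
        simp only [Set.mem_ofPred_eq, h', dist_self] at hxy
        linarith
      have hlt : ⟪(x : E3), (y : E3)⟫ < 1 :=
        (inner_lt_one_iff_real_of_norm_eq_one (norm_coe_S2 x) (norm_coe_S2 y)).2 hne
      -- The bisecting great circle of `x` and `y` separates them: the inner products with `x - y`
      -- are `±(1 - ⟪x, y⟫)`.
      refine Set.mem_iUnion.2 ⟨(x : E3) - (y : E3), ?_, ?_⟩
      · simp only [inner_sub_right, real_inner_self_eq_norm_sq, norm_coe_S2]
        linarith
      · simp only [inner_sub_right, real_inner_self_eq_norm_sq, norm_coe_S2,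
          real_inner_comm (x : E3) (y : E3)]
        linarith [real_inner_comm (x : E3) (y : E3)])
  refine ⟨V.filter (· ≠ 0), fun v hv => (Finset.mem_filter.1 hv).2, fun x y h => ?_⟩
  by_contra hxy
  obtain ⟨v, hv, h1, h2⟩ := Set.mem_iUnion₂.1 (hV (show (x, y) ∈ _ from not_lt.1 hxy))
  refine h v (Finset.mem_filter.2 ⟨hv, ?_⟩) h1 h2
  rintro rfl
  simp at h1

/-- The cell with sign pattern `s` of the arrangement of the great circles orthogonal to the
vectors in `V`, shrunk by `η`. -/
def cell (V : Finset E3) (η : ℝ) (s : V → Bool) : Set S2 :=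
  {x | ∀ v : V, η < (if s v then 1 else -1) * ⟪(x : E3), (v : E3)⟫}

theorem one_le_add_of_mem_geoSegment {x y z : S2} {a b : ℝ} (ha : 0 ≤ a) (hb : 0 ≤ b)
    (h : (z : E3) = a • (x : E3) + b • (y : E3)) : 1 ≤ a + b := by
  have := norm_add_le (a • (x : E3)) (b • (y : E3))
  rwa [← h, norm_smul, norm_smul, norm_coe_S2, norm_coe_S2, norm_coe_S2, mul_one, mul_one,
    Real.norm_of_nonneg ha, Real.norm_of_nonneg hb] at this

theorem sphericallyConvex_cell (V : Finset E3) {η : ℝ} (hη : 0 < η) (s : V → Bool) :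
    SphericallyConvex (cell V η s) := by
  rintro x hx y hy - z ⟨a, b, ha, hb, h⟩ v
  have hab := one_le_add_of_mem_geoSegment ha hb h
  have h1 := hx v
  have h2 := hy v
  rw [h, inner_add_left, real_inner_smul_left, real_inner_smul_left]
  set e : ℝ := if s v then 1 else -1
  have h3 : 0 ≤ a * (e * ⟪(x : E3), (v : E3)⟫ - η) := mul_nonneg ha (by linarith)
  have h4 : 0 ≤ b * (e * ⟪(y : E3), (v : E3)⟫ - η) := mul_nonneg hb (by linarith)
  -- Since `a + b ≥ 1`, some coefficient is positive, which keeps the bound by `(a + b) * η ≥ η`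
  -- strict.
  rcases ha.lt_or_eq with ha | rfl
  · have h5 : 0 < a * (e * ⟪(x : E3), (v : E3)⟫ - η) := mul_pos ha (by linarith)
    nlinarith
  · have h5 : 0 < b * (e * ⟪(y : E3), (v : E3)⟫ - η) := mul_pos (by linarith) (by linarith)
    nlinarith

theorem closure_cell_subset (V : Finset E3) (η : ℝ) (s : V → Bool) (v : V) :
    closure (cell V η s) ⊆ {x | η ≤ (if s v then 1 else -1) * ⟪(x : E3), (v : E3)⟫} :=
  closure_minimal (fun _ hx => (hx v).le)
    (isClosed_le continuous_const ((continuous_inner_S2 v).const_mul _))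

theorem disjoint_closure_cell (V : Finset E3) {η : ℝ} (hη : 0 < η) {s t : V → Bool}
    (hst : s ≠ t) : Disjoint (closure (cell V η s)) (closure (cell V η t)) := by
  obtain ⟨v, hv⟩ := Function.ne_iff.1 hst
  rw [Set.disjoint_left]
  intro x hx hy
  have h1 := closure_cell_subset V η s v hx
  have h2 := closure_cell_subset V η t v hy
  rw [Set.mem_ofPred_eq] at h1 h2
  cases hs : s v <;> cases ht : t v <;> simp_all <;> linarith

theorem dist_lt_of_mem_cell {V : Finset E3} {δ : ℝ}
    (hV : ∀ x y : S2, (∀ v ∈ V, 0 < ⟪(x : E3), v⟫ → ¬ ⟪(y : E3), v⟫ < 0) → dist x y < δ)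
    {η : ℝ} (hη : 0 < η) {s : V → Bool} {x y : S2} (hx : x ∈ cell V η s)
    (hy : y ∈ cell V η s) : dist x y < δ := by
  refine hV x y fun v hv h1 h2 => ?_
  have hx' := hx ⟨v, hv⟩
  have hy' := hy ⟨v, hv⟩
  cases hs : s ⟨v, hv⟩ <;> simp_all <;> linarith

theorem exists_inner_bound {K : Set S2} (hK : IsCompact K) (hfree : OrthogonalPairFree K) :
    ∃ c : ℝ, 0 < c ∧ ∀ p ∈ K, ∀ q ∈ K, c ≤ |⟪(p : E3), (q : E3)⟫| := by
  rw [orthogonalPairFree_iff] at hfree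
  rcases K.eq_empty_or_nonempty with rfl | hne
  · exact ⟨1, one_pos, by simp⟩
  · obtain ⟨⟨p, q⟩, ⟨hp, hq⟩, hmin⟩ := (hK.prod hK).exists_isMinOn (hne.prod hne)
      (f := fun r : S2 × S2 => |⟪(r.1 : E3), (r.2 : E3)⟫|) (by fun_prop)
    exact ⟨_, abs_pos.2 (hfree p hp q hq), fun p' hp' q' hq' => hmin (Set.mk_mem_prod hp' hq')⟩

theorem abs_inner_sub_inner_le (x y x' y' : S2) :
    |⟪(x : E3), (y : E3)⟫ - ⟪(x' : E3), (y' : E3)⟫| ≤ dist x x' + dist y y' := by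
  have h : ⟪(x : E3), (y : E3)⟫ - ⟪(x' : E3), (y' : E3)⟫ =
      ⟪(x : E3) - x', (y : E3)⟫ + ⟪(x' : E3), (y : E3) - y'⟫ := by
    rw [inner_sub_left, inner_sub_right]; ring
  rw [h]
  refine (abs_add_le _ _).trans (add_le_add ?_ ?_)
  · refine (abs_real_inner_le_norm _ _).trans ?_
    rw [norm_coe_S2, mul_one, Subtype.dist_eq, dist_eq_norm]
  · refine (abs_real_inner_le_norm _ _).trans ?_
    rw [norm_coe_S2, one_mul, Subtype.dist_eq, dist_eq_norm]

/-- The union of the shrunken cells that meet a compact orthogonal-pair-free set. -/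
theorem iUnion_cell_mem_classA {K : Set S2} {c : ℝ}
    (hK : ∀ p ∈ K, ∀ q ∈ K, c ≤ |⟪(p : E3), (q : E3)⟫|) {V : Finset E3}
    (hV : ∀ x y : S2, (∀ v ∈ V, 0 < ⟪(x : E3), v⟫ → ¬ ⟪(y : E3), v⟫ < 0) → dist x y < c / 2)
    {η : ℝ} (hη : 0 < η) :
    (⋃ s : {s : V → Bool // (K ∩ cell V η s).Nonempty}, cell V η s) ∈ classA := by
  classical
  refine ⟨?_, ?_⟩
  · rw [orthogonalPairFree_iff]
    intro p hp q hq h0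
    obtain ⟨⟨s, p', hp'K, hp's⟩, hps⟩ := Set.mem_iUnion.1 hp
    obtain ⟨⟨t, q', hq'K, hq't⟩, hqt⟩ := Set.mem_iUnion.1 hq
    have h1 := dist_lt_of_mem_cell hV hη hp's hps
    have h2 := dist_lt_of_mem_cell hV hη hq't hqt
    have h3 := abs_inner_sub_inner_le p' q' p q
    have h4 := hK p' hp'K q' hq'K
    rw [h0, sub_zero] at h3
    linarith
  · let e := Fintype.equivFin {s : V → Bool // (K ∩ cell V η s).Nonempty}
    refine ⟨_, fun i => cell V η (e.symm i : V → Bool), fun i => sphericallyConvex_cell V hη _,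
      fun i j hij => disjoint_closure_cell V hη fun h => hij (e.symm.injective (Subtype.ext h)),
      ?_⟩
    exact (e.symm.surjective.iUnion_comp
      fun s : {s : V → Bool // (K ∩ cell V η s).Nonempty} => cell V η s).symm

/-- The strips removed around the circles shrink to a null set as `η → 0`; continuity of measure
from below applies. -/
theorem exists_shrink_lt_measure {K : Set S2} {V : Finset E3}
    (hV : ∀ v ∈ V, v ≠ 0) {r : ENNReal} (hr : r < μ K) :
    ∃ η : ℝ, 0 < η ∧ r < μ (K ∩ {x | ∀ v ∈ V, η < |⟪(x : E3), v⟫|}) := by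
  let G : ℕ → Set S2 := fun n => K ∩ {x | ∀ v ∈ V, 1 / ((n : ℝ) + 1) < |⟪(x : E3), v⟫|}
  have hmono : Monotone G := fun m n hmn x hx =>
    ⟨hx.1, fun v hv => (Nat.one_div_le_one_div hmn).trans_lt (hx.2 v hv)⟩
  have hsub : K ⊆ (⋃ n, G n) ∪ ⋃ v ∈ V, {x : S2 | ⟪(x : E3), v⟫ = 0} := by
    intro x hx
    by_cases h : ∃ v ∈ V, ⟪(x : E3), v⟫ = 0
    · obtain ⟨v, hv, h⟩ := h
      exact Or.inr (Set.mem_biUnion (show v ∈ (V : Set E3) from hv) h)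
    · push Not at h
      left
      have hn : ∀ v ∈ V, ∀ᶠ n : ℕ in Filter.atTop, 1 / ((n : ℝ) + 1) < |⟪(x : E3), v⟫| :=
        fun v hv => tendsto_one_div_add_atTop_nhds_zero_nat.eventually_lt_const
          (abs_pos.2 (h v hv))
      obtain ⟨n, hn⟩ := ((Finset.eventually_all V).2 hn).exists
      exact Set.mem_iUnion.2 ⟨n, hx, hn⟩
  have hnull : μ (⋃ v ∈ V, {x : S2 | ⟪(x : E3), v⟫ = 0}) = 0 :=
    (measure_biUnion_null_iff V.countable_toSet).2 fun v hv => μ_greatCircle (hV v hv)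
  have hlt : r < μ (⋃ n, G n) := by
    refine hr.trans_le ((measure_mono hsub).trans ((measure_union_le _ _).trans ?_))
    rw [hnull, add_zero]
  rw [hmono.measure_iUnion, lt_iSup_iff] at hlt
  obtain ⟨n, hn⟩ := hlt
  exact ⟨_, Nat.one_div_pos_of_nat, hn⟩

theorem exists_classA_lt_measure {S : Set S2} (hS : NullMeasurableSet S μ)
    (hfree : OrthogonalPairFree S) {r : ENNReal} (hr : r < μ S) :
    ∃ T ∈ classA, r < μ T := by
  -- Inner regularity needs a Borel set, and passing to a subset preserves orthogonal-pair-freeness.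
  obtain ⟨S', hS'S, hS'm, hS'eq⟩ := hS.exists_measurable_subset_ae_eq
  rw [← measure_congr hS'eq] at hr
  obtain ⟨K, hKS, hK, hrK⟩ := hS'm.exists_lt_isCompact hr
  obtain ⟨c, hc, hKc⟩ := exists_inner_bound hK (hfree.mono (hKS.trans hS'S))
  obtain ⟨V, hV0, hV⟩ := exists_finset_separating (half_pos hc)
  obtain ⟨η, hη, hlt⟩ := exists_shrink_lt_measure hV0 hrK
  refine ⟨_, iUnion_cell_mem_classA hKc hV hη, hlt.trans_le (measure_mono ?_)⟩
  rintro x ⟨hxK, hx⟩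
  -- A point of `K` off the strips lies in the cell of its own sign pattern, which therefore meets
  -- `K`.
  have hmem : x ∈ cell V η fun v => decide (0 < ⟪(x : E3), (v : E3)⟫) := by
    intro v
    have h := hx v v.2
    by_cases h0 : 0 < ⟪(x : E3), (v : E3)⟫
    · simpa [h0, abs_of_pos h0] using h
    · simpa [h0, abs_of_nonpos (not_lt.1 h0)] using h
  exact Set.mem_iUnion.2 ⟨⟨_, x, hxK, hmem⟩, hmem⟩

theorem α₃_eq_iSup_classA : α₃ = ⨆ S ∈ classA, μ S := by
  refine le_antisymm (iSup₂_le fun S hS => le_of_forall_lt fun r hr => ?_)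
    (iSup₂_le fun S hS => le_iSup₂_of_le S ⟨nullMeasurableSet_of_mem_classA hS, hS.1⟩ le_rfl)
  obtain ⟨T, hT, hlt⟩ := exists_classA_lt_measure hS.1 hS.2 hr
  exact hlt.trans_le (le_iSup₂_of_le T hT le_rfl)

/-! ### The double cap and its area -/

theorem inner_northPole (p : S2) : ⟪(northPole : E3), (p : E3)⟫ = (p : E3) 2 := by
  simp [northPole, EuclideanSpace.inner_single_left]

theorem geoDist_lt_pi_div_four_iff (p q : S2) :
    geoDist p q < Real.pi / 4 ↔ √2 / 2 < ⟪(p : E3), (q : E3)⟫ := by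
  have hcos : Real.cos (geoDist p q) = ⟪(p : E3), (q : E3)⟫ := by
    rw [geoDist, InnerProductGeometry.cos_angle, norm_coe_S2, norm_coe_S2, mul_one, div_one]
  rw [← hcos, ← Real.cos_pi_div_four]
  exact (Real.strictAntiOn_cos.lt_iff_gt ⟨by positivity, by linarith [Real.pi_pos]⟩
    ⟨InnerProductGeometry.angle_nonneg _ _, InnerProductGeometry.angle_le_pi _ _⟩).symm

theorem mem_doubleCap_iff (p : S2) : p ∈ doubleCap ↔ 1 / 2 < (p : E3) 2 ^ 2 := by
  have h1 : geoDist northPole p < Real.pi / 4 ↔ √2 / 2 < (p : E3) 2 := by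
    rw [geoDist_lt_pi_div_four_iff, inner_northPole]
  have h2 : geoDist (-northPole) p < Real.pi / 4 ↔ √2 / 2 < -(p : E3) 2 := by
    rw [geoDist_lt_pi_div_four_iff, coe_neg_sphere, inner_neg_left, inner_northPole]
  have h3 : (1 / 2 : ℝ) = (√2 / 2) ^ 2 := by
    rw [div_pow, Real.sq_sqrt zero_le_two]; norm_num
  rw [doubleCap, Set.mem_union, Set.mem_ofPred_eq, Set.mem_ofPred_eq, h1, h2, h3, sq_lt_sq,
    abs_of_nonneg (by positivity : 0 ≤ √2 / 2), lt_abs]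

theorem measurableSet_doubleCap : MeasurableSet doubleCap := by
  have : doubleCap = {p : S2 | 1 / 2 < (p : E3) 2 ^ 2} := Set.ext mem_doubleCap_iff
  rw [this]
  exact (isOpen_lt continuous_const (by fun_prop)).measurableSet

/-- By the triangle inequality, points of one cap are closer than `π / 2`; negating one of two
points in opposite caps shows that they are farther apart than `π / 2`. -/
theorem orthogonalPairFree_doubleCap : OrthogonalPairFree doubleCap := by
  have tri : ∀ n p q : S2, geoDist n p < Real.pi / 4 → geoDist n q < Real.pi / 4 →
      geoDist p q < Real.pi / 2 := by
    intro n p q hp hq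
    have h := InnerProductGeometry.angle_le_angle_add_angle (p : E3) (n : E3) (q : E3)
    rw [InnerProductGeometry.angle_comm (p : E3) (n : E3)] at h
    simp only [geoDist] at *
    linarith
  have neg_right : ∀ p q : S2, geoDist p (-q) = Real.pi - geoDist p q := fun p q =>
    InnerProductGeometry.angle_neg_right _ _
  have neg_swap : ∀ p q : S2, geoDist (-p) q = geoDist p (-q) := by
    intro p q
    rw [neg_right]
    exact InnerProductGeometry.angle_neg_left _ _
  rintro p (hp | hp) q (hq | hq) h
  · exact (tri _ _ _ hp hq).ne h
  · rw [Set.mem_ofPred_eq, neg_swap] at hq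
    have := tri _ _ _ hp hq
    rw [neg_right] at this
    linarith
  · rw [Set.mem_ofPred_eq, ← neg_neg q, ← neg_swap] at hq
    have := tri _ _ _ hp hq
    rw [neg_right] at this
    linarith
  · exact (tri _ _ _ hp hq).ne h

theorem cone_doubleCap :
    Set.Ioo (0 : ℝ) 1 • ((↑) '' doubleCap : Set E3) =
      {x : E3 | x 0 ^ 2 + x 1 ^ 2 < min (x 2 ^ 2) (1 - x 2 ^ 2)} := by
  have hnorm : ∀ x : E3, ‖x‖ ^ 2 = x 0 ^ 2 + x 1 ^ 2 + x 2 ^ 2 := fun x => by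
    simp [EuclideanSpace.norm_sq_eq, Fin.sum_univ_three]
  ext x
  rw [Set.mem_ofPred_eq, lt_min_iff]
  constructor
  · rintro ⟨r, ⟨hr0, hr1⟩, _, ⟨p, hp, rfl⟩, rfl⟩
    rw [mem_doubleCap_iff] at hp
    have h := hnorm p
    rw [norm_coe_S2] at h
    simp only [PiLp.smul_apply, smul_eq_mul, mul_pow]
    have hr2 : 0 < r ^ 2 := by positivity
    have hr3 : r ^ 2 < 1 := by nlinarith
    constructor <;> nlinarith
  · rintro ⟨h1, h2⟩
    have h := hnorm x
    have hx : 0 < ‖x‖ := by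
      refine norm_pos_iff.2 ?_
      rintro rfl
      simp at h1
    have hx1 : ‖x‖ < 1 := by nlinarith
    refine ⟨‖x‖, ⟨hx, hx1⟩, ‖x‖⁻¹ • x, ⟨⟨‖x‖⁻¹ • x, ?_⟩, ?_, rfl⟩, smul_inv_smul₀ hx.ne' x⟩
    · rw [mem_sphere_zero_iff_norm, norm_smul, norm_inv, norm_norm, inv_mul_cancel₀ hx.ne']
    · rw [mem_doubleCap_iff]
      simp only [PiLp.smul_apply, smul_eq_mul, mul_pow, inv_pow]
      rw [inv_mul_eq_div, div_lt_div_iff₀ two_pos (by positivity)]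
      linarith

/-- For `m ≤ 0` both sides vanish, so slices missing the cone need no separate treatment. -/
theorem volume_disc (m : ℝ) :
    volume {y : Fin 2 → ℝ | y 0 ^ 2 + y 1 ^ 2 < m} = ENNReal.ofReal m * ENNReal.ofReal Real.pi := by
  have h : WithLp.toLp 2 ⁻¹' Metric.ball (0 : EuclideanSpace ℝ (Fin 2)) √m =
      {y : Fin 2 → ℝ | y 0 ^ 2 + y 1 ^ 2 < m} := by
    ext y
    rw [Set.mem_preimage, mem_ball_zero_iff, Real.lt_sqrt (norm_nonneg _),
      EuclideanSpace.norm_sq_eq]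
    simp [Fin.sum_univ_two]
  rw [← h, (PiLp.volume_preserving_toLp (Fin 2)).measure_preimage
    measurableSet_ball.nullMeasurableSet, EuclideanSpace.volume_ball_fin_two,
    ← ENNReal.ofReal_pow (Real.sqrt_nonneg m), Real.sq_sqrt', ENNReal.ofReal_max]
  simp

theorem lintegral_slice_area :
    ∫⁻ z : ℝ, ENNReal.ofReal (min (z ^ 2) (1 - z ^ 2)) =
      ENNReal.ofReal (4 / 3 * (1 - 1 / √2)) := by
  -- The two terms of the minimum cross at `z = ±c`: the cone bounds the slice inside, the unit ball
  -- outside.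
  set c : ℝ := 1 / √2 with hc
  have hc0 : 0 < c := by positivity
  have hc2 : c ^ 2 = 1 / 2 := by rw [hc, div_pow, Real.sq_sqrt zero_le_two]; norm_num
  have hc1 : c < 1 := by nlinarith
  have hcont : Continuous fun z : ℝ => min (z ^ 2) (1 - z ^ 2) := by fun_prop
  have hsupp : ∀ z : ℝ, ENNReal.ofReal (min (z ^ 2) (1 - z ^ 2)) =
      (Set.Ioc (-1 : ℝ) 1).indicator
        (fun z => ENNReal.ofReal (min (z ^ 2) (1 - z ^ 2))) z := by
    intro z
    by_cases hz : z ∈ Set.Ioc (-1 : ℝ) 1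
    · rw [Set.indicator_of_mem hz]
    · rw [Set.indicator_of_notMem hz, ENNReal.ofReal_eq_zero]
      refine (min_le_right _ _).trans ?_
      rw [Set.mem_Ioc, not_and_or, not_lt, not_le] at hz
      rcases hz with hz | hz <;> nlinarith
  rw [lintegral_congr hsupp, lintegral_indicator measurableSet_Ioc,
    ← ofReal_integral_eq_lintegral_ofReal (hcont.intervalIntegrable (-1) 1).1,
    ← intervalIntegral.integral_of_le (by norm_num)]
  · congr 1
    have hi : ∀ a b : ℝ, IntervalIntegrable (fun z : ℝ => min (z ^ 2) (1 - z ^ 2)) volume a b :=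
      fun a b => hcont.intervalIntegrable a b
    have hout : ∀ z : ℝ, 1 / 2 ≤ z ^ 2 → min (z ^ 2) (1 - z ^ 2) = 1 - z ^ 2 :=
      fun z hz => min_eq_right (by linarith)
    have hin : ∀ z : ℝ, z ^ 2 ≤ 1 / 2 → min (z ^ 2) (1 - z ^ 2) = z ^ 2 :=
      fun z hz => min_eq_left (by linarith)
    have h1 : ∫ z in (-1 : ℝ)..(-c), min (z ^ 2) (1 - z ^ 2) = ∫ z in (-1 : ℝ)..(-c), (1 - z ^ 2) := by
      refine intervalIntegral.integral_congr fun z hz => hout z ?_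
      rw [Set.uIcc_of_le (by linarith)] at hz
      nlinarith [hz.2]
    have h2 : ∫ z in (-c)..c, min (z ^ 2) (1 - z ^ 2) = ∫ z in (-c)..c, z ^ 2 := by
      refine intervalIntegral.integral_congr fun z hz => hin z ?_
      rw [Set.uIcc_of_le (by linarith)] at hz
      nlinarith [hz.1, hz.2]
    have h3 : ∫ z in c..1, min (z ^ 2) (1 - z ^ 2) = ∫ z in c..1, (1 - z ^ 2) := by
      refine intervalIntegral.integral_congr fun z hz => hout z ?_
      rw [Set.uIcc_of_le hc1.le] at hz
      nlinarith [hz.1]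
    rw [← intervalIntegral.integral_add_adjacent_intervals (hi (-1) (-c)) (hi (-c) 1),
      ← intervalIntegral.integral_add_adjacent_intervals (hi (-c) c) (hi c 1), h1, h2, h3]
    have h4 : ∀ a b : ℝ, ∫ z in a..b, (1 - z ^ 2) = (b - a) - (b ^ 3 - a ^ 3) / 3 := by
      intro a b
      rw [intervalIntegral.integral_sub (by simp) (by simp), integral_pow]
      norm_num
    rw [h4, h4, integral_pow]
    have hc3 : c ^ 3 = c / 2 := by rw [pow_succ, hc2]; ring
    norm_num
    rw [show (-c) ^ 3 = -(c ^ 3) by ring, hc3]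
    ring
  · filter_upwards [ae_restrict_mem measurableSet_Ioc] with z hz
    have h : 0 ≤ 1 - z ^ 2 := by nlinarith [hz.1, hz.2]
    exact le_min (sq_nonneg z) h

/-- Cavalieri's principle along the polar axis: the slice at height `z` is a disc of squared radius
`min (z ^ 2) (1 - z ^ 2)`, empty if this is not positive. -/
theorem volume_cone_doubleCap :
    volume {x : E3 | x 0 ^ 2 + x 1 ^ 2 < min (x 2 ^ 2) (1 - x 2 ^ 2)} =
      ENNReal.ofReal (4 / 3 * (1 - 1 / √2)) * ENNReal.ofReal Real.pi := by
  let T : Set (ℝ × (Fin 2 → ℝ)) :=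
    {w | w.2 0 ^ 2 + w.2 1 ^ 2 < min (w.1 ^ 2) (1 - w.1 ^ 2)}
  have hT : MeasurableSet T := (isOpen_lt (by fun_prop) (by fun_prop)).measurableSet
  have hmp := (volume_preserving_piFinSuccAbove (fun _ : Fin 3 => ℝ) 2).comp
    (PiLp.volume_preserving_ofLp (Fin 3))
  have hpre : {x : E3 | x 0 ^ 2 + x 1 ^ 2 < min (x 2 ^ 2) (1 - x 2 ^ 2)} =
      (MeasurableEquiv.piFinSuccAbove (fun _ : Fin 3 => ℝ) 2 ∘ WithLp.ofLp) ⁻¹' T := by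
    ext x
    rfl
  rw [hpre, hmp.measure_preimage hT.nullMeasurableSet, Measure.volume_eq_prod,
    Measure.prod_apply hT, ← lintegral_slice_area,
    ← lintegral_mul_const _ (by fun_prop)]
  exact lintegral_congr fun z => volume_disc (min (z ^ 2) (1 - z ^ 2))

theorem μ_doubleCap : μ doubleCap = ENNReal.ofReal (1 - 1 / √2) := by
  have hle : 1 / √2 ≤ 1 := by
    rw [div_le_one (by positivity)]
    exact Real.one_le_sqrt.2 one_le_two
  rw [μ_apply measurableSet_doubleCap, cone_doubleCap, volume_cone_doubleCap,
    EuclideanSpace.volume_ball_fin_three, ENNReal.ofReal_one, one_pow, one_mul,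
    ← ENNReal.ofReal_inv_of_pos (by positivity), ← ENNReal.ofReal_mul' Real.pi_pos.le,
    ← ENNReal.ofReal_mul (by positivity)]
  congr 1
  field_simp

theorem μ_doubleCap_le_α₃ : μ doubleCap ≤ α₃ :=
  le_iSup₂_of_le doubleCap
    ⟨measurableSet_doubleCap.nullMeasurableSet, orthogonalPairFree_doubleCap⟩ le_rfl

theorem exists_classA_doubleCap_lt (h : ¬ DoubleCapConjecture) :
    ∃ S ∈ classA, μ doubleCap < μ S := by
  have hlt : μ doubleCap < α₃ := lt_of_le_of_ne μ_doubleCap_le_α₃ (Ne.symm h)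
  rw [α₃_eq_iSup_classA] at hlt
  simpa only [lt_iSup_iff, exists_prop] using hlt

end OrthFree

theorem theorem1 :
    (∀ S ∈ OrthFree.classA, NullMeasurableSet S OrthFree.μ) ∧
    (OrthFree.α₃ = ⨆ S ∈ OrthFree.classA, OrthFree.μ S) ∧
    OrthFree.μ OrthFree.doubleCap = ENNReal.ofReal (1 - 1 / Real.sqrt 2) ∧
    (¬ OrthFree.DoubleCapConjecture →
      ∃ S ∈ OrthFree.classA, OrthFree.μ OrthFree.doubleCap < OrthFree.μ S) :=
  ⟨fun _ => OrthFree.nullMeasurableSet_of_mem_classA, OrthFree.α₃_eq_iSup_classA,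
    OrthFree.μ_doubleCap, OrthFree.exists_classA_doubleCap_lt⟩
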